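/- For complex numbers $w,z$ with $w\notin\{-1,-2,\dots\}$ put $$\binom wz=\frac{\Gamma(w+1)}{\Gamma(z+1)\,\Gamma(w-z+1)},$$ where $1/\Gamma$ denotes the entire reciprocal Gamma function (so $1/\Gamma$ vanishes at $0,-1,-2,\dots$), and for $z\in\mathbb C$ put $\operatorname{sinc}(z)=\dfrac{\sin(\pi z)}{\pi z}$ if $z\neq 0$ and $\operatorname{sinc}(0)=1$. Then for every $w\in\mathbb C$ with $\operatorname{Re}(w)>-1$ and every $z\in\mathbb C$ the function $x\mapsto\binom wx\operatorname{sinc}(x-z)$ is Lebesgue integrable on $\mathbb R$ and $$\int_{-\infty}^{\infty}\binom wx\,\operatorname{sinc}(x-z)\,dx=\binom wz .$$ -/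

import Mathlib

/-- The binomial coefficient with two complex arguments,
`Γ(w + 1) / (Γ(z + 1) Γ(w - z + 1))`, for `w` not a negative integer.
Here `1 / Γ` is the entire reciprocal Gamma function: Mathlib's `Complex.Gamma` takes the
value `0` at its poles, so that the quotient is `0` there, as it should be. -/
noncomputable def complexBinom (w z : ℂ) : ℂ :=
  Complex.Gamma (w + 1) / (Complex.Gamma (z + 1) * Complex.Gamma (w - z + 1))

/-- The normalized cardinal sine of a complex argument. -/
noncomputable def normalizedSinc (z : ℂ) : ℂ :=
  if z = 0 then 1 else Complex.sin (Real.pi * z) / (Real.pi * z)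

open Complex MeasureTheory Filter Topology

/-! ### Recurrences of the complex binomial coefficient -/

/-! On the band `[-1/2, 1/2]`, `binom w x` is the Fourier transform of `(1 + exp (2πiv)) ^ w` and
`sinc (x - z)` that of `exp (2πivz)`. The theorem is therefore the sampling identity for
band-limited functions: move the transform from one factor to the other and invert
(`integral_complexBinom_mul_normalizedSinc_add_two`).

Inversion needs integrability in `x`, which is proved only for large `Re w`. Pascal's rule brings
the identity down to `Re w > -1`: the defect at `w` satisfies `D z = -D (z - 1)` and tends to `0`
along `z + n`, so it vanishes (`integral_complexBinom_mul_normalizedSinc_of_add_one`). The decay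
comes from writing the binomial as a beta integral times a sine.

The Fourier coefficient itself is identified in `fourierBinom_eq_complexBinom`: integration by parts
relates `(w, z)` to `(w + 2n, z + n)`, Laplace's method gives the asymptotics there, and the
accumulated products are Euler's approximations to `Gamma`. -/

theorem complexBinom_eq_mul_inv (w z : ℂ) :
    complexBinom w z = Gamma (w + 1) * ((Gamma (z + 1))⁻¹ * (Gamma (w - z + 1))⁻¹) := by
  rw [complexBinom, div_eq_mul_inv, mul_inv]

theorem continuous_complexBinom (w : ℂ) : Continuous (complexBinom w) := by
  have h := differentiable_one_div_Gamma.continuous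
  have h1 : Continuous fun z : ℂ => (Gamma (z + 1))⁻¹ := h.comp (by fun_prop)
  have h2 : Continuous fun z : ℂ => (Gamma (w - z + 1))⁻¹ :=
    h.comp (f := fun z : ℂ => w - z + 1) (by fun_prop)
  have : complexBinom w =
      fun z => Gamma (w + 1) * ((Gamma (z + 1))⁻¹ * (Gamma (w - z + 1))⁻¹) :=
    funext (complexBinom_eq_mul_inv w)
  rw [this]
  fun_prop

/-- The recurrence of `1 / Γ` holds at the poles of `Γ` too, so `z` is unrestricted. -/
theorem sub_mul_complexBinom_add_one {w : ℂ} (hw : w + 1 ≠ 0) (z : ℂ) :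
    (w + 1 - z) * complexBinom (w + 1) z = (w + 1) * complexBinom w z := by
  rw [complexBinom_eq_mul_inv, complexBinom_eq_mul_inv, Gamma_add_one _ hw,
    one_div_Gamma_eq_self_mul_one_div_Gamma_add_one (w - z + 1),
    show w + 1 - z + 1 = w - z + 1 + 1 by ring]
  ring

theorem mul_complexBinom_add_one {w : ℂ} (hw : w + 1 ≠ 0) (z : ℂ) :
    z * complexBinom (w + 1) z = (w + 1) * complexBinom w (z - 1) := by
  rw [complexBinom_eq_mul_inv, complexBinom_eq_mul_inv, Gamma_add_one _ hw,
    show z - 1 + 1 = z by ring, one_div_Gamma_eq_self_mul_one_div_Gamma_add_one z,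
    show w - (z - 1) + 1 = w + 1 - z + 1 by ring]
  ring

theorem complexBinom_add_one {w : ℂ} (hw : w + 1 ≠ 0) (z : ℂ) :
    complexBinom (w + 1) z = complexBinom w z + complexBinom w (z - 1) := by
  refine mul_left_cancel₀ hw ?_
  linear_combination sub_mul_complexBinom_add_one hw z + mul_complexBinom_add_one hw z

/-! ### Decay of the complex binomial coefficient -/

theorem add_one_ne_zero_of_neg_one_lt_re {w : ℂ} (hw : -1 < w.re) : w + 1 ≠ 0 := by
  intro h
  have := congrArg re h
  simp at this
  linarith

theorem norm_sin_le_exp_abs_im (u : ℂ) : ‖Complex.sin u‖ ≤ Real.exp |u.im| := by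
  rw [Complex.sin, norm_div, norm_mul, norm_I, mul_one]
  have h1 : ‖cexp (-u * I)‖ ≤ Real.exp |u.im| := by
    rw [norm_exp]; simpa using le_abs_self u.im
  have h2 : ‖cexp (u * I)‖ ≤ Real.exp |u.im| := by
    rw [norm_exp]; simpa using neg_le_abs u.im
  have h3 := norm_sub_le (cexp (-u * I)) (cexp (u * I))
  have : ‖(2 : ℂ)‖ = 2 := by simp
  rw [this]
  linarith

/-- Taking absolute values in the integrand leaves a real beta integral, and lowering the exponent
of `1 - x ≤ 1` only enlarges it. -/
theorem norm_betaIntegral_le {p q : ℂ} {a : ℝ} (hp : 0 < p.re) (ha : 0 < a) (haq : a ≤ q.re) :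
    ‖betaIntegral p q‖ ≤ Real.Gamma p.re * Real.Gamma a / Real.Gamma (p.re + a) := by
  have hint : IntervalIntegrable (fun x : ℝ => x ^ (p.re - 1) * (1 - x) ^ (a - 1)) volume 0 1 := by
    have h := (betaIntegral_convergent (u := (p.re : ℂ)) (v := (a : ℂ)) (by simpa) (by simpa)).norm
    refine h.congr_ae ?_
    rw [Filter.EventuallyEq, ae_restrict_iff' measurableSet_uIoc]
    -- At `x = 1` the base `1 - x` is zero, and the norm formula for `cpow` needs a positive base.
    filter_upwards [Measure.ae_ne volume (1 : ℝ)] with x hx1 hx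
    rw [Set.uIoc_of_le zero_le_one] at hx
    have hx2 : 0 < 1 - x := sub_pos.2 (lt_of_le_of_ne hx.2 hx1)
    have e : (1 : ℂ) - (x : ℂ) = ((1 - x : ℝ) : ℂ) := by push_cast; ring
    rw [norm_mul, e, norm_cpow_eq_rpow_re_of_pos hx.1, norm_cpow_eq_rpow_re_of_pos hx2]
    simp
  have hval : ∫ x : ℝ in 0..1, x ^ (p.re - 1) * (1 - x) ^ (a - 1)
      = Real.Gamma p.re * Real.Gamma a / Real.Gamma (p.re + a) := by
    have h := Gamma_mul_Gamma_eq_betaIntegral (s := (p.re : ℂ)) (t := (a : ℂ)) (by simpa) (by simpa)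
    have hb : betaIntegral (p.re : ℂ) (a : ℂ)
        = ((∫ x : ℝ in 0..1, x ^ (p.re - 1) * (1 - x) ^ (a - 1) : ℝ) : ℂ) := by
      rw [betaIntegral, ← intervalIntegral.integral_ofReal]
      refine intervalIntegral.integral_congr fun x hx => ?_
      rw [Set.uIcc_of_le zero_le_one] at hx
      rw [ofReal_mul, ofReal_cpow hx.1, ofReal_cpow (sub_nonneg.2 hx.2)]
      push_cast
      rfl
    rw [hb, Gamma_ofReal, Gamma_ofReal, ← ofReal_add, Gamma_ofReal] at h
    rw [eq_div_iff (Real.Gamma_pos_of_pos (by linarith)).ne', mul_comm]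
    exact_mod_cast h.symm
  rw [← hval, betaIntegral]
  refine intervalIntegral.norm_integral_le_of_norm_le zero_le_one ?_ hint
  filter_upwards [Measure.ae_ne volume (1 : ℝ)] with x hx1 hx
  have hx2 : 0 < 1 - x := sub_pos.2 (lt_of_le_of_ne hx.2 hx1)
  have e : (1 : ℂ) - (x : ℂ) = ((1 - x : ℝ) : ℂ) := by push_cast; ring
  rw [norm_mul, e, norm_cpow_eq_rpow_re_of_pos hx.1, norm_cpow_eq_rpow_re_of_pos hx2]
  simp only [sub_re, one_re]
  exact mul_le_mul_of_nonneg_left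
    (Real.rpow_le_rpow_of_exponent_ge hx2 (by linarith [hx.1]) (by linarith))
    (Real.rpow_nonneg hx.1.le _)

/-- Log-convexity of `Γ` at `y + 1 = a (y + a) + (1 - a) (y + a + 1)`, followed by `y + a ≤ 2 y`. -/
theorem Gamma_div_Gamma_add_le {y a : ℝ} (hy : 1 ≤ y) (ha : 0 < a) (ha1 : a < 1) :
    Real.Gamma y / Real.Gamma (y + a) ≤ 2 * y ^ (-a) := by
  have hy0 : 0 < y := by linarith
  have hpos : 0 < Real.Gamma (y + a) := Real.Gamma_pos_of_pos (by linarith)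
  have h := Real.Gamma_mul_add_mul_le_rpow_Gamma_mul_rpow_Gamma (s := y + a) (t := y + a + 1)
    (a := a) (b := 1 - a) (by linarith) (by linarith) ha (by linarith) (by ring)
  rw [show a * (y + a) + (1 - a) * (y + a + 1) = y + 1 by ring, Real.Gamma_add_one hy0.ne',
    Real.Gamma_add_one (by linarith : y + a ≠ 0),
    Real.mul_rpow (by linarith) hpos.le, mul_left_comm, ← Real.rpow_add hpos,
    show a + (1 - a) = 1 by ring, Real.rpow_one] at h
  have h2 : (y + a) ^ (1 - a) ≤ 2 * y ^ (1 - a) := by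
    calc (y + a) ^ (1 - a) ≤ (2 * y) ^ (1 - a) :=
          Real.rpow_le_rpow (by linarith) (by linarith) (by linarith)
      _ = 2 ^ (1 - a) * y ^ (1 - a) := Real.mul_rpow (by norm_num) hy0.le
      _ ≤ 2 ^ (1 : ℝ) * y ^ (1 - a) := by
          gcongr
          · norm_num
          · linarith
      _ = 2 * y ^ (1 - a) := by rw [Real.rpow_one]
  rw [div_le_iff₀ hpos]
  refine le_of_mul_le_mul_left ?_ hy0
  calc y * Real.Gamma y ≤ (y + a) ^ (1 - a) * Real.Gamma (y + a) := h
    _ ≤ 2 * y ^ (1 - a) * Real.Gamma (y + a) := by gcongr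
    _ = y * (2 * y ^ (-a) * Real.Gamma (y + a)) := by
        rw [sub_eq_add_neg, Real.rpow_add hy0, Real.rpow_one]; ring

theorem norm_betaIntegral_le_rpow {p q : ℂ} {a : ℝ} (hp : 1 ≤ p.re) (ha : 0 < a) (ha1 : a < 1)
    (haq : a ≤ q.re) : ‖betaIntegral p q‖ ≤ 2 * Real.Gamma a * p.re ^ (-a) := by
  refine (norm_betaIntegral_le (by linarith) ha haq).trans ?_
  have := mul_le_mul_of_nonneg_left (Gamma_div_Gamma_add_le hp ha ha1) (Real.Gamma_pos_of_pos ha).le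
  calc _ = Real.Gamma a * (Real.Gamma p.re / Real.Gamma (p.re + a)) := by ring
    _ ≤ _ := this
    _ = _ := by ring

/-- Reflection turns `1 / Γ (w - z + 1)` into `Γ (z - w)` times a sine; the remaining Gamma quotient
is a beta function. The version for `Re z < 0` reflects the other factor. -/
theorem complexBinom_eq_betaIntegral_right {w z : ℂ} (hw : -1 < w.re) (hz : w.re < z.re) :
    complexBinom w z = betaIntegral (z - w) (w + 1) * (sin (Real.pi * (z - w)) / Real.pi) := by
  have h1 := Gamma_mul_Gamma_eq_betaIntegral (s := z - w) (t := w + 1)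
    (by simpa using hz) (by simp; linarith)
  have h2 := Gamma_mul_Gamma_one_sub (z - w)
  have hz1 : Gamma (z + 1) ≠ 0 := Gamma_ne_zero_of_re_pos (by simp; linarith)
  have hz2 : Gamma (z - w) ≠ 0 := Gamma_ne_zero_of_re_pos (by simpa using hz)
  rw [show z - w + (w + 1) = z + 1 by ring] at h1
  rw [← inv_div, ← h2, complexBinom, show 1 - (z - w) = w - z + 1 by ring, mul_inv]
  rw [eq_comm, mul_comm] at h1
  rw [← eq_div_iff hz1] at h1
  rw [h1]
  field_simp

theorem complexBinom_eq_betaIntegral_left {w z : ℂ} (hw : -1 < w.re) (hz : z.re < 0) :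
    complexBinom w z = betaIntegral (-z) (w + 1) * (sin (Real.pi * (-z)) / Real.pi) := by
  have h1 := Gamma_mul_Gamma_eq_betaIntegral (s := -z) (t := w + 1)
    (by simpa using hz) (by simp; linarith)
  have h2 := Gamma_mul_Gamma_one_sub (-z)
  have hz1 : Gamma (w - z + 1) ≠ 0 := Gamma_ne_zero_of_re_pos (by simp; linarith)
  have hz2 : Gamma (-z) ≠ 0 := Gamma_ne_zero_of_re_pos (by simpa using hz)
  rw [show -z + (w + 1) = w - z + 1 by ring] at h1
  rw [← inv_div, ← h2, complexBinom, show 1 - (-z) = z + 1 by ring, mul_inv]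
  rw [eq_comm, mul_comm] at h1
  rw [← eq_div_iff hz1] at h1
  rw [h1]
  field_simp

theorem norm_sin_pi_mul_div_pi_le (u : ℂ) :
    ‖sin (Real.pi * u) / Real.pi‖ ≤ Real.exp (Real.pi * |u.im|) := by
  rw [norm_div, norm_real, Real.norm_of_nonneg Real.pi_pos.le]
  refine (div_le_self (norm_nonneg _) (by linarith [Real.pi_gt_three])).trans ?_
  refine (norm_sin_le_exp_abs_im _).trans_eq ?_
  simp [abs_mul, abs_of_pos Real.pi_pos]

theorem norm_complexBinom_le_right {w z : ℂ} {a : ℝ} (ha : 0 < a) (ha1 : a < 1)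
    (haw : a ≤ w.re + 1) (hz : 1 ≤ (z - w).re) :
    ‖complexBinom w z‖ ≤
      2 * Real.Gamma a * (z - w).re ^ (-a) * Real.exp (Real.pi * |(z - w).im|) := by
  have hz' : w.re < z.re := by simp at hz; linarith
  rw [complexBinom_eq_betaIntegral_right (by linarith) hz', norm_mul]
  exact mul_le_mul (norm_betaIntegral_le_rpow hz ha ha1 (by simpa using haw))
    (norm_sin_pi_mul_div_pi_le _) (norm_nonneg _)
    (mul_nonneg (by have := Real.Gamma_pos_of_pos ha; positivity)
      (Real.rpow_nonneg (by linarith) _))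

theorem norm_complexBinom_le_left {w z : ℂ} {a : ℝ} (ha : 0 < a) (ha1 : a < 1)
    (haw : a ≤ w.re + 1) (hz : 1 ≤ (-z).re) :
    ‖complexBinom w z‖ ≤
      2 * Real.Gamma a * (-z).re ^ (-a) * Real.exp (Real.pi * |(-z).im|) := by
  have hz' : z.re < 0 := by simp at hz; linarith
  rw [complexBinom_eq_betaIntegral_left (by linarith) hz', norm_mul]
  exact mul_le_mul (norm_betaIntegral_le_rpow hz ha ha1 (by simpa using haw))
    (norm_sin_pi_mul_div_pi_le _) (norm_nonneg _)
    (mul_nonneg (by have := Real.Gamma_pos_of_pos ha; positivity)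
      (Real.rpow_nonneg (by linarith) _))

theorem tendsto_complexBinom_add_natCast {w : ℂ} (hw : -1 < w.re) (z : ℂ) :
    Tendsto (fun n : ℕ => complexBinom w (z + n)) atTop (𝓝 0) := by
  set a : ℝ := min (w.re + 1) (1 / 2)
  have ha : 0 < a := lt_min (by linarith) (by norm_num)
  have hlim : Tendsto (fun n : ℕ => (z - w).re + (n : ℝ)) atTop atTop :=
    tendsto_atTop_add_const_left _ _ tendsto_natCast_atTop_atTop
  have h : Tendsto (fun n : ℕ => 2 * Real.Gamma a * ((z - w).re + n) ^ (-a) *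
      Real.exp (Real.pi * |(z - w).im|)) atTop (𝓝 0) := by
    have := (((tendsto_rpow_neg_atTop ha).comp hlim).const_mul
      (2 * Real.Gamma a)).mul_const (Real.exp (Real.pi * |(z - w).im|))
    simpa using this
  refine squeeze_zero_norm' ?_ h
  filter_upwards [hlim.eventually_ge_atTop 1] with n hn
  have e1 : (z + n - w).re = (z - w).re + n := by simp; ring
  have e2 : (z + n - w).im = (z - w).im := by simp
  have := norm_complexBinom_le_right (w := w) (z := z + n) ha
    ((min_le_right _ _).trans_lt (by norm_num)) (min_le_left _ _) (by rw [e1]; exact hn)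
  rwa [e1, e2] at this

theorem norm_complexBinom_ofReal_le {w : ℂ} (hw : -1 < w.re) :
    ∃ a C : ℝ, 0 < a ∧ a < 1 ∧ 0 ≤ C ∧
      ∀ x : ℝ, ‖complexBinom w x‖ ≤ C * (1 + |x|) ^ (-a) := by
  -- The cap `1 / 2` secures `a < 1`, as the Gamma-ratio bound requires.
  set a : ℝ := min (w.re + 1) (1 / 2)
  have ha : 0 < a := lt_min (by linarith) (by norm_num)
  have ha1 : a < 1 := (min_le_right _ _).trans_lt (by norm_num)
  have hG := Real.Gamma_pos_of_pos ha
  -- Beyond `R`, both `|x| - |Re w| ≥ |x| / 2` and `|x| / 2 ≥ 1` hold, so one of the two tail bounds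
  -- applies.
  set R : ℝ := 2 * |w.re| + 2
  have hR : 0 ≤ R := by positivity
  obtain ⟨M, hM⟩ := (isCompact_Icc (a := -R) (b := R)).exists_bound_of_continuousOn
    (f := fun x : ℝ => complexBinom w x)
    ((continuous_complexBinom w).comp continuous_ofReal).continuousOn
  have hM0 : 0 ≤ M := (norm_nonneg _).trans (hM 0 (by simp [hR]))
  set E : ℝ := Real.exp (Real.pi * |w.im|)
  have hE : 1 ≤ E := Real.one_le_exp (by positivity)
  have key : ∀ x y : ℝ, R ≤ |x| → |x| / 2 ≤ y → y ^ (-a) ≤ 4 * (1 + |x|) ^ (-a) := by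
    intro x y hx hy
    have hx2 : 2 ≤ |x| := by have := abs_nonneg w.re; linarith
    calc y ^ (-a) ≤ ((1 + |x|) / 4) ^ (-a) :=
          Real.rpow_le_rpow_of_nonpos (by positivity) (by linarith) (by linarith)
      _ = (1 + |x|) ^ (-a) * 4 ^ a := by
          rw [Real.div_rpow (by positivity) (by norm_num), Real.rpow_neg (by norm_num : (0:ℝ) ≤ 4),
            div_inv_eq_mul]
      _ ≤ (1 + |x|) ^ (-a) * 4 ^ (1 : ℝ) := by
          gcongr
          norm_num
      _ = _ := by rw [Real.rpow_one, mul_comm]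
  refine ⟨a, M * (1 + R) ^ a + 2 * Real.Gamma a * 4 * E, ha, ha1, by positivity, fun x => ?_⟩
  have hx0 : (0 : ℝ) < 1 + |x| := by positivity
  by_cases hx : |x| ≤ R
  · have h1 : 1 ≤ (1 + R) ^ a * (1 + |x|) ^ (-a) := by
      rw [Real.rpow_neg hx0.le, ← div_eq_mul_inv, one_le_div (Real.rpow_pos_of_pos hx0 _)]
      exact Real.rpow_le_rpow hx0.le (by linarith) ha.le
    calc ‖complexBinom w x‖ ≤ M * 1 := by rw [mul_one]; exact hM x (abs_le.1 hx)
      _ ≤ M * ((1 + R) ^ a * (1 + |x|) ^ (-a)) := by gcongr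
      _ ≤ M * ((1 + R) ^ a * (1 + |x|) ^ (-a)) + 2 * Real.Gamma a * 4 * E * (1 + |x|) ^ (-a) :=
          le_add_of_nonneg_right (by positivity)
      _ = _ := by ring
  · have hx := (not_le.1 hx).le
    have hw1 := le_abs_self w.re
    have hw2 := abs_nonneg w.re
    have main : ‖complexBinom w x‖ ≤ 2 * Real.Gamma a * (4 * (1 + |x|) ^ (-a)) * E := by
      rcases le_total 0 x with h | h
      · have hy : |x| / 2 ≤ ((x : ℂ) - w).re := by
          simp only [sub_re, ofReal_re]; rw [abs_of_nonneg h] at *; linarith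
        refine (norm_complexBinom_le_right ha ha1 (min_le_left _ _) (by linarith)).trans ?_
        simp only [sub_im, ofReal_im, zero_sub, abs_neg]
        gcongr
        exact key x _ hx hy
      · have hy : |x| / 2 ≤ (-(x : ℂ)).re := by
          simp only [neg_re, ofReal_re]; rw [abs_of_nonpos h] at *; linarith
        refine (norm_complexBinom_le_left ha ha1 (min_le_left _ _) (by linarith)).trans ?_
        gcongr
        · exact key x _ hx hy
        · simpa using hE
    calc _ ≤ _ := main
      _ = 2 * Real.Gamma a * 4 * E * (1 + |x|) ^ (-a) := by ring
      _ ≤ M * (1 + R) ^ a * (1 + |x|) ^ (-a) + 2 * Real.Gamma a * 4 * E * (1 + |x|) ^ (-a) :=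
          le_add_of_nonneg_left (by positivity)
      _ = _ := by ring

/-! ### The cardinal sine -/

/-- This form absorbs the removable singularity: continuity and the exponential-type bound can be
read off it. -/
theorem normalizedSinc_eq_integral (u : ℂ) :
    normalizedSinc u = ∫ v : ℝ in (-1 / 2)..(1 / 2), cexp (2 * Real.pi * I * u * v) := by
  have hpi : (Real.pi : ℂ) ≠ 0 := ofReal_ne_zero.2 Real.pi_ne_zero
  rw [normalizedSinc]
  split_ifs with h
  · subst h
    norm_num
  · rw [integral_exp_mul_complex (by simp [hpi, h]), Complex.sin]
    push_cast
    rw [show 2 * (Real.pi : ℂ) * I * u * (1 / 2) = Real.pi * u * I by ring,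
      show 2 * (Real.pi : ℂ) * I * u * (-1 / 2) = -(Real.pi * u) * I by ring]
    field_simp
    rw [I_sq]
    ring

theorem continuous_normalizedSinc : Continuous normalizedSinc := by
  rw [funext normalizedSinc_eq_integral]
  exact intervalIntegral.continuous_parametric_intervalIntegral_of_continuous' (by fun_prop) _ _

theorem norm_normalizedSinc_le (u : ℂ) : ‖normalizedSinc u‖ ≤ Real.exp (Real.pi * |u.im|) := by
  rw [normalizedSinc_eq_integral]
  refine (intervalIntegral.norm_integral_le_of_norm_le_const
    (C := Real.exp (Real.pi * |u.im|)) fun v hv => ?_).trans_eq (by norm_num)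
  rw [Set.uIoc_of_le (by norm_num)] at hv
  rw [norm_exp, Real.exp_le_exp]
  have hv' : |v| ≤ 1 / 2 := abs_le.2 ⟨by linarith [hv.1], hv.2⟩
  have : (2 * Real.pi * I * u * v : ℂ).re = -(2 * Real.pi * (u.im * v)) := by
    simp; ring
  rw [this]
  have h1 : |u.im * v| ≤ |u.im| * (1 / 2) := by rw [abs_mul]; gcongr
  have h2 := neg_abs_le (u.im * v)
  have h3 := Real.pi_pos
  nlinarith

theorem norm_mul_normalizedSinc_le (u : ℂ) :
    ‖u * normalizedSinc u‖ ≤ Real.exp (Real.pi * |u.im|) := by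
  by_cases h : u = 0
  · simp [h]
  · have hpi : (Real.pi : ℂ) ≠ 0 := ofReal_ne_zero.2 Real.pi_ne_zero
    have e : u * normalizedSinc u = sin (Real.pi * u) / Real.pi := by
      rw [normalizedSinc, if_neg h]; field_simp
    rw [e]
    exact norm_sin_pi_mul_div_pi_le u

theorem norm_normalizedSinc_sub_le (z : ℂ) :
    ∃ C : ℝ, 0 ≤ C ∧ ∀ x : ℝ, ‖normalizedSinc (x - z)‖ ≤ C * (1 + |x|)⁻¹ := by
  refine ⟨2 * Real.exp (Real.pi * |z.im|) * (1 + ‖z‖), by positivity, fun x => ?_⟩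
  have h1 := norm_normalizedSinc_le (x - z)
  have h2 := norm_mul_normalizedSinc_le (x - z)
  rw [norm_mul] at h2
  have e : |((x : ℂ) - z).im| = |z.im| := by simp
  rw [e] at h1 h2
  rw [← div_eq_mul_inv, le_div_iff₀ (by positivity)]
  have h3 : |x| ≤ ‖(x : ℂ) - z‖ + ‖z‖ := by
    simpa using norm_add_le ((x : ℂ) - z) z
  have h4 : 1 + |x| ≤ (1 + ‖z‖) * (1 + ‖(x : ℂ) - z‖) := by
    have := mul_nonneg (norm_nonneg z) (norm_nonneg ((x : ℂ) - z))
    linarith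
  calc ‖normalizedSinc (x - z)‖ * (1 + |x|)
      ≤ ‖normalizedSinc (x - z)‖ * ((1 + ‖z‖) * (1 + ‖(x : ℂ) - z‖)) := by gcongr
    _ = (1 + ‖z‖) * (‖normalizedSinc (x - z)‖ + ‖(x : ℂ) - z‖ * ‖normalizedSinc (x - z)‖) := by ring
    _ ≤ (1 + ‖z‖) * (Real.exp (Real.pi * |z.im|) + Real.exp (Real.pi * |z.im|)) := by gcongr
    _ = _ := by ring

/-! ### Integrability, and descent from `w + 1` to `w` -/

theorem integrable_complexBinom_mul_normalizedSinc {w : ℂ} (hw : -1 < w.re) (z : ℂ) :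
    Integrable fun x : ℝ => complexBinom w x * normalizedSinc (x - z) := by
  obtain ⟨a, C, ha, -, hC, hf⟩ := norm_complexBinom_ofReal_le hw
  obtain ⟨D, hD, hs⟩ := norm_normalizedSinc_sub_le z
  have hi : Integrable fun x : ℝ => C * D * (1 + ‖x‖) ^ (-(1 + a)) :=
    (integrable_one_add_norm (by simpa using ha)).const_mul _
  have hcont : Continuous fun x : ℝ => complexBinom w x * normalizedSinc (x - z) :=
    ((continuous_complexBinom w).comp continuous_ofReal).mul
      (continuous_normalizedSinc.comp (by fun_prop))
  refine hi.mono' hcont.aestronglyMeasurable (ae_of_all _ fun x => ?_)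
  have hx : (0 : ℝ) < 1 + |x| := by positivity
  rw [norm_mul]
  calc _ ≤ C * (1 + |x|) ^ (-a) * (D * (1 + |x|)⁻¹) :=
        mul_le_mul (hf x) (hs x) (norm_nonneg _) (by positivity)
    _ = C * D * ((1 + |x|) ^ (-a) * (1 + |x|) ^ (-1 : ℝ)) := by
        rw [Real.rpow_neg_one]; ring
    _ = _ := by
        rw [← Real.rpow_add hx, Real.norm_eq_abs]; congr 2; ring

/-- Split off `(A * B) ^ (-a/4)` to gain decay in `N`. The leftover exponents `3a/4` and `1 - a/4`
add up to `1 + a/2 > 1`, so replacing both bases by the smaller one leaves an integrable power. -/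
theorem rpow_neg_mul_inv_le {A B N a : ℝ} (hA : 1 ≤ A) (hB : 1 ≤ B) (hN : 0 < N)
    (hNAB : N ≤ A * B) (ha : 0 < a) (ha1 : a < 1) :
    A ^ (-a) * B⁻¹ ≤ N ^ (-(a / 4)) * (A ^ (-(1 + a / 2)) + B ^ (-(1 + a / 2))) := by
  have hA0 : 0 < A := by linarith
  have hB0 : 0 < B := by linarith
  have h1 : A ^ (-a) * B⁻¹ =
      (A * B) ^ (-(a / 4)) * (A ^ (-(3 * a / 4)) * B ^ (-(1 - a / 4))) := by
    rw [Real.mul_rpow hA0.le hB0.le, mul_mul_mul_comm, ← Real.rpow_add hA0, ← Real.rpow_add hB0,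
      ← Real.rpow_neg_one B]
    congr 2 <;> ring
  have h2 : (A * B) ^ (-(a / 4)) ≤ N ^ (-(a / 4)) :=
    Real.rpow_le_rpow_of_nonpos hN hNAB (by linarith)
  have h3 : A ^ (-(3 * a / 4)) * B ^ (-(1 - a / 4)) ≤
      A ^ (-(1 + a / 2)) + B ^ (-(1 + a / 2)) := by
    rcases le_total A B with h | h
    · calc _ ≤ A ^ (-(3 * a / 4)) * A ^ (-(1 - a / 4)) := by
            gcongr 1
            exact Real.rpow_le_rpow_of_nonpos hA0 h (by linarith)
        _ = A ^ (-(1 + a / 2)) := by rw [← Real.rpow_add hA0]; congr 1; ring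
        _ ≤ _ := le_add_of_nonneg_right (by positivity)
    · calc _ ≤ B ^ (-(3 * a / 4)) * B ^ (-(1 - a / 4)) := by
            gcongr 1
            exact Real.rpow_le_rpow_of_nonpos hB0 h (by linarith)
        _ = B ^ (-(1 + a / 2)) := by rw [← Real.rpow_add hB0]; congr 1; ring
        _ ≤ _ := le_add_of_nonneg_left (by positivity)
  rw [h1]
  exact mul_le_mul h2 h3 (by positivity) (by positivity)

theorem tendsto_integral_complexBinom_mul_normalizedSinc {w : ℂ} (hw : -1 < w.re) (z : ℂ) :
    Tendsto (fun n : ℕ => ∫ x : ℝ, complexBinom w x * normalizedSinc (x - (z + n)))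
      atTop (𝓝 0) := by
  obtain ⟨a, C, ha, ha1, hC, hf⟩ := norm_complexBinom_ofReal_le hw
  obtain ⟨D, hD, hs⟩ := norm_normalizedSinc_sub_le z
  have hJ : Integrable fun x : ℝ => (1 + |x|) ^ (-(1 + a / 2)) := by
    have := integrable_one_add_norm (E := ℝ) (μ := volume) (r := 1 + a / 2) (by simpa using ha)
    simpa using this
  set J := ∫ x : ℝ, (1 + |x|) ^ (-(1 + a / 2))
  have hlim : Tendsto (fun n : ℕ => (1 + (n : ℝ)) ^ (-(a / 4)) * (C * D * (J + J))) atTop (𝓝 0) := by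
    have := ((tendsto_rpow_neg_atTop (by linarith : 0 < a / 4)).comp
      (tendsto_atTop_add_const_left _ (1 : ℝ) tendsto_natCast_atTop_atTop)).mul_const
      (C * D * (J + J))
    simpa using this
  refine squeeze_zero_norm (fun n => ?_) hlim
  have hJn : Integrable fun x : ℝ => (1 + |x + n|) ^ (-(1 + a / 2)) := hJ.comp_add_right (n : ℝ)
  have hJn' : ∫ x : ℝ, (1 + |x + n|) ^ (-(1 + a / 2)) = J :=
    integral_add_right_eq_self (fun x : ℝ => (1 + |x|) ^ (-(1 + a / 2))) (n : ℝ)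
  have hshift : ∫ x : ℝ, complexBinom w x * normalizedSinc (x - (z + n)) =
      ∫ x : ℝ, complexBinom w ((x + n : ℝ) : ℂ) * normalizedSinc (x - z) := by
    rw [← integral_add_right_eq_self _ (n : ℝ)]
    refine integral_congr_ae (ae_of_all _ fun x => ?_)
    simp
  rw [hshift]
  refine (norm_integral_le_of_norm_le (g := fun x : ℝ => (1 + (n : ℝ)) ^ (-(a / 4)) * (C * D *
    ((1 + |x + n|) ^ (-(1 + a / 2)) + (1 + |x|) ^ (-(1 + a / 2))))) ?_ ?_).trans_eq ?_
  · exact ((hJn.add hJ).const_mul _).const_mul _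
  · refine ae_of_all _ fun x => ?_
    -- The two peaks are `n` apart, so `x` is far from at least one of them.
    have hN : 1 + (n : ℝ) ≤ (1 + |x + n|) * (1 + |x|) := by
      have h1 : (n : ℝ) ≤ |x + n| + |x| := by
        have := abs_sub (x + n) x
        simpa using this
      have := mul_nonneg (abs_nonneg (x + n)) (abs_nonneg x)
      linarith
    rw [norm_mul]
    calc _ ≤ C * (1 + |x + n|) ^ (-a) * (D * (1 + |x|)⁻¹) :=
          mul_le_mul (hf _) (hs x) (norm_nonneg _) (by positivity)
      _ = C * D * ((1 + |x + n|) ^ (-a) * (1 + |x|)⁻¹) := by ring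
      _ ≤ C * D * ((1 + (n : ℝ)) ^ (-(a / 4)) *
            ((1 + |x + n|) ^ (-(1 + a / 2)) + (1 + |x|) ^ (-(1 + a / 2)))) := by
          exact mul_le_mul_of_nonneg_left
            (rpow_neg_mul_inv_le (by simp) (by simp) (by positivity) hN ha ha1) (by positivity)
      _ = _ := by ring
  · rw [integral_const_mul, integral_const_mul, integral_add hJn hJ, hJn']

theorem integral_complexBinom_mul_normalizedSinc_of_add_one {w : ℂ} (hw : -1 < w.re)
    (h : ∀ z : ℂ, ∫ x : ℝ, complexBinom (w + 1) x * normalizedSinc (x - z) =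
      complexBinom (w + 1) z) (z : ℂ) :
    ∫ x : ℝ, complexBinom w x * normalizedSinc (x - z) = complexBinom w z := by
  set D : ℂ → ℂ := fun z =>
    (∫ x : ℝ, complexBinom w x * normalizedSinc (x - z)) - complexBinom w z with hD
  have hw1 := add_one_ne_zero_of_neg_one_lt_re hw
  -- Pascal's rule on both sides; translating `x` by one turns `binom w (x - 1)` against `sinc (x -
  -- z)` into the integral at `z - 1`.
  have hstep : ∀ z, D z + D (z - 1) = 0 := by
    intro z
    have hs : ∀ x : ℝ, complexBinom w ((x + (-1) : ℝ) : ℂ) *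
        normalizedSinc (((x + (-1) : ℝ) : ℂ) - (z - 1)) =
        complexBinom w (x - 1) * normalizedSinc (x - z) := by
      intro x
      push_cast
      rw [show (x : ℂ) + -1 = x - 1 by ring, show (x : ℂ) - 1 - (z - 1) = x - z by ring]
    have h1 := integral_add_right_eq_self (μ := volume)
      (fun x : ℝ => complexBinom w x * normalizedSinc (x - (z - 1))) (-1)
    have h1' := (integrable_complexBinom_mul_normalizedSinc hw (z - 1)).comp_add_right (-1)
    simp only [hs] at h1 h1'
    have h2 := integral_add (integrable_complexBinom_mul_normalizedSinc hw z) h1'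
    have h3 := h z
    simp only [complexBinom_add_one hw1, add_mul] at h3
    simp only [hD]
    rw [← h1]
    linear_combination h3 - h2
  have hnorm : ∀ n : ℕ, ‖D (z + n)‖ = ‖D z‖ := by
    intro n
    induction n with
    | zero => simp
    | succ n ih =>
      rw [← ih, ← norm_neg (D (z + n))]
      congr 1
      have := hstep (z + (n + 1 : ℕ))
      rw [show z + ((n + 1 : ℕ) : ℂ) - 1 = z + n by push_cast; ring] at this
      linear_combination this
  have hlim : Tendsto (fun n : ℕ => ‖D (z + n)‖) atTop (𝓝 0) := by
    have := ((tendsto_integral_complexBinom_mul_normalizedSinc hw z).sub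
      (tendsto_complexBinom_add_natCast hw z)).norm
    simpa using this
  simp only [hnorm] at hlim
  have : ‖D z‖ = 0 := tendsto_nhds_unique tendsto_const_nhds hlim
  exact sub_eq_zero.1 (norm_eq_zero.1 this)

/-! ### The complex binomial coefficient as a Fourier coefficient of `(1 + exp (2 π i v)) ^ w` -/

/-- The function `v ↦ (1 + exp (2 π i v)) ^ w * exp (-2 π i v z)` on `[-1/2, 1/2]`. -/
noncomputable def binomKernel (w z : ℂ) (v : ℝ) : ℂ :=
  ((2 * Real.cos (Real.pi * v) : ℝ) : ℂ) ^ w * cexp (2 * Real.pi * I * v * (w / 2 - z))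

/-- The Fourier integral of `binomKernel` over `[-1/2, 1/2]`. -/
noncomputable def fourierBinom (w z : ℂ) : ℂ :=
  ∫ v : ℝ in (-1 / 2)..(1 / 2), binomKernel w z v

theorem continuous_binomKernel {w : ℂ} (hw : 0 < w.re) (z : ℂ) : Continuous (binomKernel w z) :=
  ((continuous_ofReal_cpow_const hw).comp (f := fun v : ℝ => 2 * Real.cos (Real.pi * v))
    (by fun_prop)).mul (by fun_prop)

theorem ofReal_cpow_add_one {w : ℂ} (hw : 0 < w.re) (x : ℝ) : (x : ℂ) ^ (w + 1) = (x : ℂ) ^ w * x := by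
  by_cases hx : (x : ℂ) = 0
  · rw [hx, zero_cpow, mul_zero]
    exact add_one_ne_zero_of_neg_one_lt_re (by linarith)
  · rw [cpow_add _ _ hx, cpow_one]

theorem binomKernel_add_one {w : ℂ} (hw : 0 < w.re) (z : ℂ) (v : ℝ) :
    binomKernel (w + 1) z v = binomKernel w z v + binomKernel w (z - 1) v := by
  simp only [binomKernel]
  rw [ofReal_cpow_add_one hw]
  set E := cexp (2 * Real.pi * I * v * (w / 2 - z))
  have e1 : cexp (2 * Real.pi * I * v * ((w + 1) / 2 - z)) = E * cexp (Real.pi * v * I) := by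
    rw [← Complex.exp_add]; congr 1; ring
  have e2 : cexp (2 * Real.pi * I * v * (w / 2 - (z - 1))) =
      E * (cexp (Real.pi * v * I) * cexp (Real.pi * v * I)) := by
    rw [← Complex.exp_add, ← Complex.exp_add]; congr 1; ring
  have e3 : ((2 * Real.cos (Real.pi * v) : ℝ) : ℂ) =
      cexp (Real.pi * v * I) + cexp (-(Real.pi * v) * I) := by
    push_cast
    rw [Complex.cos]; ring
  have e4 : cexp (-(Real.pi * v) * I) * cexp (Real.pi * v * I) = 1 := by
    rw [← Complex.exp_add, show -((Real.pi : ℂ) * v) * I + Real.pi * v * I = 0 by ring,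
      Complex.exp_zero]
  rw [e1, e2]
  generalize ((2 * Real.cos (Real.pi * v) : ℝ) : ℂ) ^ w = p
  rw [e3]
  linear_combination p * E * e4

theorem fourierBinom_add_one {w : ℂ} (hw : 0 < w.re) (z : ℂ) :
    fourierBinom (w + 1) z = fourierBinom w z + fourierBinom w (z - 1) := by
  simp only [fourierBinom]
  rw [← intervalIntegral.integral_add ((continuous_binomKernel hw z).intervalIntegrable _ _)
    ((continuous_binomKernel hw (z - 1)).intervalIntegrable _ _)]
  simp only [binomKernel_add_one hw]

theorem cos_pi_mul_pos {v : ℝ} (hv : v ∈ Set.Ioo (-1 / 2 : ℝ) (1 / 2)) :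
    0 < Real.cos (Real.pi * v) :=
  Real.cos_pos_of_mem_Ioo ⟨by nlinarith [hv.1, Real.pi_pos], by nlinarith [hv.2, Real.pi_pos]⟩

/-- With `E = exp (2πiv)` the kernel is `(1 + E) ^ (w + 1) * E ^ (-z)`; differentiating the first
factor brings out an extra `E`, which shifts `z` to `z - 1`. -/
theorem hasDerivAt_binomKernel {w : ℂ} (hw : 0 < w.re) (z : ℂ) {v : ℝ}
    (hv : v ∈ Set.Ioo (-1 / 2 : ℝ) (1 / 2)) :
    HasDerivAt (binomKernel (w + 1) z) (2 * Real.pi * I *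
      ((w + 1) * binomKernel w (z - 1) v - z * binomKernel (w + 1) z v)) v := by
  have hc := cos_pi_mul_pos hv
  have h0 : HasDerivAt (fun v : ℝ => 2 * Real.cos (Real.pi * v))
      (2 * (-Real.sin (Real.pi * v) * (Real.pi * 1))) v :=
    (((hasDerivAt_id v).const_mul Real.pi).cos).const_mul 2
  have h1 := (hasDerivAt_ofReal_cpow_const (x := 2 * Real.cos (Real.pi * v)) (by positivity)
    (add_one_ne_zero_of_neg_one_lt_re (w := w) (by linarith))).scomp v h0
  have h2 : HasDerivAt (fun v : ℝ => cexp (2 * Real.pi * I * v * ((w + 1) / 2 - z)))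
      (cexp (2 * Real.pi * I * v * ((w + 1) / 2 - z)) *
        (2 * Real.pi * I * 1 * ((w + 1) / 2 - z))) v :=
    (((hasDerivAt_id v).ofReal_comp.const_mul (2 * Real.pi * I)).mul_const _).cexp
  refine (h1.mul h2).congr_deriv ?_
  simp only [binomKernel, Function.comp_apply, add_sub_cancel_right]
  rw [ofReal_cpow_add_one hw]
  have e : cexp (2 * Real.pi * I * v * (w / 2 - (z - 1))) =
      cexp (2 * Real.pi * I * v * ((w + 1) / 2 - z)) *
        (cos (Real.pi * v) + sin (Real.pi * v) * I) := by
    rw [← Complex.exp_mul_I, ← Complex.exp_add]; congr 1; ring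
  rw [e]
  generalize ((2 * Real.cos (Real.pi * v) : ℝ) : ℂ) ^ w = p
  push_cast [real_smul]
  linear_combination (-2 * Real.pi * (w + 1) * p * cexp (2 * Real.pi * I * v * ((w + 1) / 2 - z)) *
    sin (Real.pi * v)) * I_sq

theorem binomKernel_of_cos_eq_zero {w : ℂ} (hw : 0 < w.re) (z : ℂ) {v : ℝ}
    (hv : Real.cos (Real.pi * v) = 0) : binomKernel w z v = 0 := by
  have : w ≠ 0 := by rintro rfl; simp at hw
  simp [binomKernel, hv, zero_cpow this]

theorem binomKernel_half {w : ℂ} (hw : 0 < w.re) (z : ℂ) : binomKernel w z (1 / 2) = 0 :=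
  binomKernel_of_cos_eq_zero hw z (by rw [mul_one_div, Real.cos_pi_div_two])

theorem binomKernel_neg_half {w : ℂ} (hw : 0 < w.re) (z : ℂ) : binomKernel w z (-1 / 2) = 0 :=
  binomKernel_of_cos_eq_zero hw z (by
    rw [show Real.pi * (-1 / 2) = -(Real.pi / 2) by ring, Real.cos_neg, Real.cos_pi_div_two])

/-- The kernel vanishes at both ends of the band, so its derivative integrates to zero. -/
theorem mul_fourierBinom_add_one {w : ℂ} (hw : 0 < w.re) (z : ℂ) :
    z * fourierBinom (w + 1) z = (w + 1) * fourierBinom w (z - 1) := by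
  have hw1 : 0 < (w + 1).re := by simp; linarith
  have hi1 := (continuous_binomKernel hw1 z).intervalIntegrable (μ := volume) (-1 / 2) (1 / 2)
  have hi2 := (continuous_binomKernel hw (z - 1)).intervalIntegrable (μ := volume) (-1 / 2) (1 / 2)
  have h := intervalIntegral.integral_eq_sub_of_hasDerivAt_of_le (by norm_num)
    (continuous_binomKernel hw1 z).continuousOn (fun v hv => hasDerivAt_binomKernel hw z hv)
    (((hi2.const_mul (w + 1)).sub (hi1.const_mul z)).const_mul (2 * Real.pi * I))
  rw [binomKernel_half hw1, binomKernel_neg_half hw1, sub_zero,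
    intervalIntegral.integral_const_mul,
    intervalIntegral.integral_sub (hi2.const_mul (w + 1)) (hi1.const_mul z),
    intervalIntegral.integral_const_mul, intervalIntegral.integral_const_mul] at h
  have h2 := (mul_eq_zero.1 h).resolve_left (by simp [Real.pi_ne_zero])
  exact (sub_eq_zero.1 h2).symm

theorem sub_mul_fourierBinom_add_one {w : ℂ} (hw : 0 < w.re) (z : ℂ) :
    (w + 1 - z) * fourierBinom (w + 1) z = (w + 1) * fourierBinom w z := by
  linear_combination (w + 1) * fourierBinom_add_one hw z - mul_fourierBinom_add_one hw z

/-- This step preserves `w / 2 - z`, hence the exponential factor; only the power of the cosine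
grows, which is the setting of Laplace's method. -/
theorem fourierBinom_add_two {w : ℂ} (hw : 0 < w.re) (z : ℂ) :
    (w - z + 1) * (z + 1) * fourierBinom (w + 2) (z + 1) =
      (w + 1) * (w + 2) * fourierBinom w z := by
  have h1 := sub_mul_fourierBinom_add_one hw z
  have h2 := mul_fourierBinom_add_one (w := w + 1) (by simp; linarith) (z + 1)
  rw [add_sub_cancel_right, show w + 1 + 1 = w + 2 by ring] at h2
  linear_combination (w + 2) * h1 + (w + 1 - z) * h2

/-! ### Evaluation of the Fourier integral: Laplace asymptotics and Euler's limit for `Γ`. -/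

theorem integral_cos_pi_mul_sq_pow (n : ℕ) :
    ∫ v : ℝ in (-1 / 2)..(1 / 2), (Real.cos (Real.pi * v) ^ 2) ^ n = n.centralBinom / 4 ^ n := by
  have h : ∀ n : ℕ, ∫ v : ℝ in (-1 / 2)..(1 / 2), (Real.cos (Real.pi * v) ^ 2) ^ n =
      Real.pi⁻¹ * ∫ x in (-(Real.pi / 2))..(Real.pi / 2), Real.cos x ^ (2 * n) := by
    intro n
    have := intervalIntegral.integral_comp_mul_left (a := -1 / 2) (b := 1 / 2)
      (fun x => Real.cos x ^ (2 * n)) Real.pi_ne_zero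
    simp only [← pow_mul]
    rw [this, smul_eq_mul]
    congr 2 <;> ring
  induction n with
  | zero => norm_num
  | succ n ih =>
    rw [h] at ih ⊢
    rw [show 2 * (n + 1) = 2 * n + 2 by ring, integral_cos_pow, Real.cos_neg, Real.cos_pi_div_two]
    have hc : ((n : ℝ) + 1) * (n + 1).centralBinom = 2 * (2 * n + 1) * n.centralBinom := by
      exact_mod_cast Nat.succ_mul_centralBinom_succ n
    have hn : (n : ℝ) + 1 ≠ 0 := by positivity
    have hc' : ((n + 1).centralBinom : ℝ) = 2 * (2 * n + 1) * n.centralBinom / (n + 1) := by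
      rw [eq_div_iff hn]; linarith
    rw [hc', zero_pow (by omega), zero_mul, zero_mul, sub_zero, zero_div, zero_add,
      mul_left_comm, ih]
    push_cast
    rw [pow_succ]
    field_simp
    ring

theorem fourierBinom_add_two_mul (w z : ℂ) (hw : 0 < w.re) (n : ℕ) :
    fourierBinom (w + 2 * n) (z + n) =
      4 ^ n * ∫ v : ℝ in (-1 / 2)..(1 / 2), (Real.cos (Real.pi * v) ^ 2) ^ n • binomKernel w z v := by
  rw [fourierBinom, ← intervalIntegral.integral_const_mul]
  refine intervalIntegral.integral_congr fun v _ => ?_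
  have hp : ∀ x : ℝ, (x : ℂ) ^ (w + 2 * n) = (x : ℂ) ^ w * ((x : ℂ) ^ 2) ^ n := by
    intro x
    by_cases hx : (x : ℂ) = 0
    · have h0 : w ≠ 0 := by rintro rfl; simp at hw
      have h1 : w + 2 * n ≠ 0 := by
        intro h
        have := congrArg re h
        simp at this
        have hn : (0 : ℝ) ≤ n := n.cast_nonneg
        linarith
      rw [hx, zero_cpow h0, zero_cpow h1, zero_mul]
    · rw [cpow_add _ _ hx, ← pow_mul, ← cpow_natCast]
      push_cast
      rfl
  simp only [binomKernel]
  rw [hp, real_smul, show (w + 2 * n) / 2 - (z + n) = w / 2 - z by ring]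
  push_cast
  rw [mul_pow, mul_pow]
  norm_num
  ring

/-- The normalized powers of `cos² (πv)` concentrate at their unique maximum `v = 0`, where the
kernel equals `2 ^ w`. -/
theorem tendsto_fourierBinom_div_centralBinom {w : ℂ} (hw : 0 < w.re) (z : ℂ) :
    Tendsto (fun n : ℕ => fourierBinom (w + 2 * n) (z + n) / n.centralBinom) atTop
      (𝓝 (2 ^ w)) := by
  have hle : (-1 / 2 : ℝ) ≤ 1 / 2 := by norm_num
  have h := tendsto_setIntegral_pow_smul_of_unique_maximum_of_isCompact_of_continuousOn
    (μ := volume) (g := binomKernel w z) (x₀ := 0) (s := Set.Icc (-1 / 2 : ℝ) (1 / 2))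
    isCompact_Icc (c := fun v => Real.cos (Real.pi * v) ^ 2) (by fun_prop) ?_
    (fun v _ => by positivity) (by simp) ?_ (continuous_binomKernel hw z).continuousOn
  · have e0 : binomKernel w z 0 = 2 ^ w := by simp [binomKernel]
    rw [e0] at h
    refine h.congr fun n => ?_
    rw [integral_Icc_eq_integral_Ioc, integral_Icc_eq_integral_Ioc,
      ← intervalIntegral.integral_of_le hle, ← intervalIntegral.integral_of_le hle,
      integral_cos_pi_mul_sq_pow, fourierBinom_add_two_mul w z hw, real_smul]
    push_cast
    rw [inv_div]
    ring
  · intro v hv hv0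
    have h1 : Real.cos (Real.pi * v) < 1 := by
      rw [← Real.cos_zero, ← Real.cos_abs (Real.pi * v)]
      refine Real.cos_lt_cos_of_nonneg_of_le_pi le_rfl ?_ (abs_pos.2 (by simp [hv0, Real.pi_ne_zero]))
      rw [abs_mul, abs_of_pos Real.pi_pos]
      have : |v| ≤ 1 := abs_le.2 ⟨by linarith [hv.1], by linarith [hv.2]⟩
      exact mul_le_of_le_one_right Real.pi_pos.le this
    have h2 : 0 ≤ Real.cos (Real.pi * v) := Real.cos_nonneg_of_mem_Icc
      ⟨by nlinarith [hv.1, Real.pi_pos], by nlinarith [hv.2, Real.pi_pos]⟩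
    simp only [mul_zero, Real.cos_zero, one_pow]
    exact pow_lt_one₀ h2 h1 two_ne_zero
  · rw [interior_Icc, closure_Ioo (by norm_num)]
    constructor <;> norm_num

theorem tendsto_inv_GammaSeq (s : ℂ) :
    Tendsto (fun n : ℕ => (GammaSeq s n)⁻¹) atTop (𝓝 (Gamma s)⁻¹) := by
  by_cases h : Gamma s = 0
  · obtain ⟨m, rfl⟩ := (Gamma_eq_zero_iff s).1 h
    rw [h, inv_zero]
    refine tendsto_const_nhds.congr' ?_
    filter_upwards [eventually_ge_atTop m] with n hn
    have : ∏ j ∈ Finset.range (n + 1), (-(m : ℂ) + j) = 0 :=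
      Finset.prod_eq_zero (Finset.mem_range.2 (Nat.lt_succ_of_le hn)) (by simp)
    -- At a pole, `GammaSeq` is eventually a division by zero; its default value `0` gives the
    -- inverse `0`, the true value of `1 / Γ`.
    rw [GammaSeq, this, div_zero, inv_zero]
  · exact (GammaSeq_tendsto_Gamma s).inv₀ h

theorem fourierBinom_mul_prod {w : ℂ} (hw : 0 < w.re) (z : ℂ) (n : ℕ) :
    fourierBinom w z * ∏ j ∈ Finset.range (2 * n), (w + 1 + j) =
      (∏ j ∈ Finset.range n, (w - z + 1 + j)) * (∏ j ∈ Finset.range n, (z + 1 + j)) *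
        fourierBinom (w + 2 * n) (z + n) := by
  induction n with
  | zero => simp
  | succ n ih =>
    have hn : (0 : ℝ) ≤ n := n.cast_nonneg
    have h := fourierBinom_add_two (w := w + 2 * n) (by simp; linarith) (z + n)
    rw [show 2 * (n + 1) = 2 * n + 1 + 1 by ring, Finset.prod_range_succ, Finset.prod_range_succ,
      Finset.prod_range_succ, Finset.prod_range_succ]
    push_cast
    rw [show w + 2 * ((n : ℂ) + 1) = w + 2 * n + 2 by ring, ← add_assoc z]
    linear_combination (w + 1 + 2 * n) * (w + 1 + (2 * n + 1)) * ih -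
      (∏ j ∈ Finset.range n, (w - z + 1 + j)) * (∏ j ∈ Finset.range n, (z + 1 + j)) * h

theorem centralBinom_succ_eq_div (n : ℕ) :
    ((n + 1).centralBinom : ℂ) =
      2 * ((2 * n + 1).factorial : ℂ) / ((n + 1) * (n.factorial : ℂ) ^ 2) := by
  have h := Nat.add_choose_mul_factorial_mul_factorial (n + 1) (n + 1)
  rw [show n + 1 + (n + 1) = 2 * (n + 1) by ring, ← Nat.centralBinom_eq_two_mul_choose,
    show 2 * (n + 1) = (2 * n + 1) + 1 by ring, Nat.factorial_succ (2 * n + 1), Nat.factorial_succ n] at h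
  have h' := congrArg (Nat.cast (R := ℂ)) h
  push_cast at h'
  have h1 : (n : ℂ) + 1 ≠ 0 := by exact_mod_cast n.succ_ne_zero
  have h2 : (n.factorial : ℂ) ≠ 0 := by exact_mod_cast n.factorial_ne_zero
  rw [eq_div_iff (by positivity)]
  refine mul_left_cancel₀ h1 ?_
  linear_combination h'

/-- After `n + 1` double steps the products have `n + 1`, `n + 1` and `2n + 2` factors, hence the
indices `n`, `n` and `2n + 1`. The elementary correction tends to `2 ^ (-w)`, cancelling the Laplace
limit. -/
theorem fourierBinom_eq_GammaSeq {w : ℂ} (hw : 0 < w.re) (z : ℂ) {n : ℕ} (hn : n ≠ 0) :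
    fourierBinom w z = (GammaSeq (w - z + 1) n)⁻¹ * (GammaSeq (z + 1) n)⁻¹ *
      GammaSeq (w + 1) (2 * n + 1) *
      (2 * ((n / (n + 1) : ℝ) : ℂ) * ((n / (2 * n + 1) : ℝ) : ℂ) ^ (w + 1)) *
      (fourierBinom (w + 2 * (n + 1 : ℕ)) (z + (n + 1 : ℕ)) / (n + 1).centralBinom) := by
  have h := fourierBinom_mul_prod hw z (n + 1)
  rw [GammaSeq, GammaSeq, GammaSeq, show 2 * n + 1 + 1 = 2 * (n + 1) by ring]
  have hP : ∏ j ∈ Finset.range (2 * (n + 1)), (w + 1 + (j : ℂ)) ≠ 0 := by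
    refine Finset.prod_ne_zero_iff.2 fun j _ hj => ?_
    have h1 := congrArg re hj
    simp at h1
    have hj0 : (0 : ℝ) ≤ j := j.cast_nonneg
    linarith
  have hn0 : (n : ℂ) ≠ 0 := by exact_mod_cast hn
  have hn1 : (n : ℂ) + 1 ≠ 0 := by exact_mod_cast n.succ_ne_zero
  have hf : (n.factorial : ℂ) ≠ 0 := by exact_mod_cast n.factorial_ne_zero
  have hf2 : ((2 * n + 1).factorial : ℂ) ≠ 0 := by exact_mod_cast (2 * n + 1).factorial_ne_zero
  have hpow : (n : ℂ) ^ (w - z + 1) * (n : ℂ) ^ (z + 1) = n * (n : ℂ) ^ (w + 1) := by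
    rw [← cpow_add _ _ hn0, show w - z + 1 + (z + 1) = 1 + (w + 1) by ring, cpow_add _ _ hn0,
      cpow_one]
  have hquot : ((n / (2 * n + 1) : ℝ) : ℂ) ^ (w + 1) * ((2 * n + 1 : ℕ) : ℂ) ^ (w + 1) =
      (n : ℂ) ^ (w + 1) := by
    have := mul_cpow_ofReal_nonneg (a := (n / (2 * n + 1) : ℝ)) (b := (2 * n + 1 : ℝ))
      (by positivity) (by positivity) (w + 1)
    rw [← ofReal_mul, div_mul_cancel₀ _ (by positivity)] at this
    rw [← ofReal_natCast n, this]
    push_cast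
    rfl
  have hp1 : (n : ℂ) ^ (w + 1) ≠ 0 := by simp [cpow_eq_zero_iff, hn0]
  have hp2 : (n : ℂ) ^ (w - z + 1) ≠ 0 := by simp [cpow_eq_zero_iff, hn0]
  have hp3 : (n : ℂ) ^ (z + 1) ≠ 0 := by simp [cpow_eq_zero_iff, hn0]
  rw [eq_div_of_mul_eq hP h, centralBinom_succ_eq_div]
  generalize ∏ j ∈ Finset.range (2 * (n + 1)), (w + 1 + (j : ℂ)) = P at *
  generalize ∏ j ∈ Finset.range (n + 1), (w - z + 1 + (j : ℂ)) = Q at *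
  generalize ∏ j ∈ Finset.range (n + 1), (z + 1 + (j : ℂ)) = R at *
  generalize fourierBinom (w + 2 * (n + 1 : ℕ)) (z + (n + 1 : ℕ)) = F at *
  generalize ((n / (2 * n + 1) : ℝ) : ℂ) ^ (w + 1) = p4 at *
  generalize ((2 * n + 1 : ℕ) : ℂ) ^ (w + 1) = p5 at *
  generalize (n : ℂ) ^ (w + 1) = p1 at *
  generalize (n : ℂ) ^ (w - z + 1) = p2 at *
  generalize (n : ℂ) ^ (z + 1) = p3 at *
  push_cast
  rw [inv_div, inv_div]
  field_simp
  linear_combination Q * R * F * (hpow - n * hquot)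

theorem fourierBinom_eq_complexBinom {w : ℂ} (hw : 0 < w.re) (z : ℂ) :
    fourierBinom w z = complexBinom w z := by
  have hr1 : Tendsto (fun n : ℕ => (n / (n + 1) : ℝ)) atTop (𝓝 1) := tendsto_natCast_div_add_atTop 1
  have hr2 : Tendsto (fun n : ℕ => (n / (2 * n + 1) : ℝ)) atTop (𝓝 (1 / 2)) := by
    have h := (tendsto_natCast_div_add_atTop (1 / 2 : ℝ)).const_mul (1 / 2)
    rw [mul_one] at h
    refine h.congr fun n => ?_
    have : (2 * n + 1 : ℝ) = 2 * (n + 1 / 2) := by ring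
    rw [this]
    field_simp
  have hc1 := (continuous_ofReal.tendsto (1 : ℝ)).comp hr1
  have hc2 := ((continuous_ofReal_cpow_const (y := w + 1) (by simp; linarith)).tendsto
    (1 / 2 : ℝ)).comp hr2
  have h2n : Tendsto (fun n : ℕ => 2 * n + 1) atTop atTop :=
    tendsto_atTop_mono (fun n => by simp only [id]; omega) tendsto_id
  have hT := (tendsto_fourierBinom_div_centralBinom hw z).comp (tendsto_add_atTop_nat 1)
  have hlim := ((((tendsto_inv_GammaSeq (w - z + 1)).mul (tendsto_inv_GammaSeq (z + 1))).mul
    ((GammaSeq_tendsto_Gamma (w + 1)).comp h2n)).mul ((hc1.const_mul 2).mul hc2)).mul hT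
  have hconst := hlim.congr' (f₂ := fun _ => fourierBinom w z) (by
    filter_upwards [eventually_ne_atTop 0] with n hn
    exact (fourierBinom_eq_GammaSeq hw z hn).symm)
  have := tendsto_nhds_unique tendsto_const_nhds hconst
  have h2 : ((1 / 2 : ℝ) : ℂ) ^ (w + 1) * 2 ^ w * 2 = 1 := by
    have e := mul_cpow_ofReal_nonneg (a := 1 / 2) (b := 2) (by norm_num) (by norm_num) (w + 1)
    rw [← ofReal_mul, one_div_mul_cancel two_ne_zero, ofReal_one, one_cpow, ofReal_ofNat,
      cpow_add _ _ (two_ne_zero), cpow_one] at e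
    linear_combination -e
  rw [this, complexBinom_eq_mul_inv, ofReal_one]
  linear_combination (Gamma (w + 1) * ((Gamma (z + 1))⁻¹ * (Gamma (w - z + 1))⁻¹)) * h2

/-! ### Fourier inversion -/

theorem norm_fourierBinom_ofReal_le (w : ℂ) (x : ℝ) :
    ‖fourierBinom w x‖ ≤ ∫ v : ℝ in (-1 / 2)..(1 / 2), ‖binomKernel w 0 v‖ := by
  refine (intervalIntegral.norm_integral_le_integral_norm (by norm_num)).trans_eq ?_
  refine intervalIntegral.integral_congr fun v _ => ?_
  simp only [binomKernel, norm_mul, norm_exp]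
  congr 2
  simp

/-- Two recurrence steps express `x (x - 1)` times the function through a Fourier integral bounded
on the real line, giving decay of order `x⁻²`. -/
theorem integrable_fourierBinom_add_two {w : ℂ} (hw : 0 < w.re) :
    Integrable fun x : ℝ => fourierBinom (w + 2) x := by
  have hw2 : 0 < (w + 2).re := by simp; linarith
  set K := ∫ v : ℝ in (-1 / 2)..(1 / 2), ‖binomKernel w 0 v‖
  set M := ∫ v : ℝ in (-1 / 2)..(1 / 2), ‖binomKernel (w + 2) 0 v‖
  have hcont : Continuous fun x : ℝ => fourierBinom (w + 2) x := by
    simp only [fourierBinom_eq_complexBinom hw2]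
    exact (continuous_complexBinom _).comp continuous_ofReal
  refine (integrable_inv_one_add_sq.const_mul (2 * (‖(w + 2) * (w + 1)‖ * K) + 2 * M)).mono'
    hcont.aestronglyMeasurable (ae_of_all _ fun x => ?_)
  have hrec : (x : ℂ) * (x - 1) * fourierBinom (w + 2) x =
      (w + 2) * (w + 1) * fourierBinom w ((x - 2 : ℝ) : ℂ) := by
    have h1 := mul_fourierBinom_add_one (w := w + 1) (by simp; linarith) x
    have h2 := mul_fourierBinom_add_one hw ((x : ℂ) - 1)
    rw [show w + 1 + 1 = w + 2 by ring] at h1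
    rw [show (x : ℂ) - 1 - 1 = ((x - 2 : ℝ) : ℂ) by push_cast; ring] at h2
    linear_combination (x - 1) * h1 + (w + 2) * h2
  have h1 := congrArg norm hrec
  have e : (x : ℂ) * (x - 1) = ((x * (x - 1) : ℝ) : ℂ) := by push_cast; ring
  rw [norm_mul, norm_mul ((w + 2) * (w + 1)), e, norm_real, Real.norm_eq_abs] at h1
  have h2 : |x * (x - 1)| * ‖fourierBinom (w + 2) x‖ ≤ ‖(w + 2) * (w + 1)‖ * K := by
    rw [h1]
    gcongr
    exact norm_fourierBinom_ofReal_le w _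
  have h3 : ‖fourierBinom (w + 2) x‖ ≤ M := norm_fourierBinom_ofReal_le _ x
  have h4 : 1 + x ^ 2 ≤ 2 * |x * (x - 1)| + 2 := by
    have := le_abs_self (x * (x - 1))
    nlinarith [sq_nonneg (x - 1)]
  rw [← div_eq_mul_inv, le_div_iff₀ (by positivity)]
  calc _ ≤ ‖fourierBinom (w + 2) x‖ * (2 * |x * (x - 1)| + 2) := by gcongr
    _ = 2 * (|x * (x - 1)| * ‖fourierBinom (w + 2) x‖) + 2 * ‖fourierBinom (w + 2) x‖ := by ring
    _ ≤ _ := by gcongr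

theorem fourier_indicator_eq_intervalIntegral (f : ℝ → ℂ) (x : ℝ) :
    FourierTransform.fourier ((Set.Icc (-1 / 2 : ℝ) (1 / 2)).indicator f) x =
      ∫ v : ℝ in (-1 / 2)..(1 / 2), cexp (-(2 * Real.pi * I * v * x)) * f v := by
  rw [Real.fourier_real_eq_integral_exp_smul, intervalIntegral.integral_of_le (by norm_num),
    ← integral_Icc_eq_integral_Ioc, ← integral_indicator measurableSet_Icc]
  refine integral_congr_ae (ae_of_all _ fun v => ?_)
  by_cases hv : v ∈ Set.Icc (-1 / 2 : ℝ) (1 / 2)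
  · simp only [Set.indicator_of_mem hv, smul_eq_mul]
    congr 2
    push_cast
    ring
  · simp only [Set.indicator_of_notMem hv, smul_zero]

theorem fourier_indicator_binomKernel (w : ℂ) (x : ℝ) :
    FourierTransform.fourier ((Set.Icc (-1 / 2 : ℝ) (1 / 2)).indicator (binomKernel w 0)) x =
      fourierBinom w x := by
  rw [fourier_indicator_eq_intervalIntegral, fourierBinom]
  refine intervalIntegral.integral_congr fun v _ => ?_
  simp only [binomKernel]
  rw [mul_left_comm, ← Complex.exp_add]
  congr 2
  ring

theorem fourier_indicator_exp (z : ℂ) (x : ℝ) :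
    FourierTransform.fourier ((Set.Icc (-1 / 2 : ℝ) (1 / 2)).indicator
      fun v : ℝ => cexp (2 * Real.pi * I * v * z)) x = normalizedSinc (x - z) := by
  have he : normalizedSinc (x - z) = normalizedSinc (z - x) := by
    have : (x : ℂ) - z = -(z - x) := by ring
    simp only [normalizedSinc, this, neg_eq_zero, mul_neg, Complex.sin_neg, neg_div_neg_eq]
  rw [fourier_indicator_eq_intervalIntegral, he, normalizedSinc_eq_integral]
  refine intervalIntegral.integral_congr fun v _ => ?_
  rw [← Complex.exp_add]
  congr 1
  ring

theorem fourier_fourierBinom {w : ℂ} (hw : 0 < w.re) (v : ℝ) :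
    FourierTransform.fourier (fun x : ℝ => fourierBinom (w + 2) x) v =
      (Set.Icc (-1 / 2 : ℝ) (1 / 2)).indicator (binomKernel (w + 2) 0) (-v) := by
  have hw2 : 0 < (w + 2).re := by simp; linarith
  -- Truncation creates no jump because the kernel vanishes at `±1/2`; inversion then holds at every
  -- point.
  have hcont : Continuous ((Set.Icc (-1 / 2 : ℝ) (1 / 2)).indicator (binomKernel (w + 2) 0)) := by
    refine continuous_indicator (fun a ha => ?_) (continuous_binomKernel hw2 0).continuousOn
    rw [frontier_Icc (by norm_num)] at ha
    rcases ha with rfl | rfl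
    · exact binomKernel_neg_half hw2 0
    · exact binomKernel_half hw2 0
  have hint : Integrable ((Set.Icc (-1 / 2 : ℝ) (1 / 2)).indicator (binomKernel (w + 2) 0)) :=
    ((continuous_binomKernel hw2 0).continuousOn.integrableOn_Icc).integrable_indicator
      measurableSet_Icc
  have hF : FourierTransform.fourier
      ((Set.Icc (-1 / 2 : ℝ) (1 / 2)).indicator (binomKernel (w + 2) 0)) =
      fun x : ℝ => fourierBinom (w + 2) x := funext (fourier_indicator_binomKernel _)
  have h := hcont.fourierInv_fourier_eq hint (by rw [hF]; exact integrable_fourierBinom_add_two hw)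
  rw [hF] at h
  have h' := congrFun h (-v)
  rwa [Real.fourierInv_eq_fourier_neg, neg_neg] at h'

theorem integral_complexBinom_mul_normalizedSinc_add_two {w : ℂ} (hw : 0 < w.re) (z : ℂ) :
    ∫ x : ℝ, complexBinom (w + 2) x * normalizedSinc (x - z) = complexBinom (w + 2) z := by
  have hw2 : 0 < (w + 2).re := by simp; linarith
  simp only [← fourierBinom_eq_complexBinom hw2]
  set k : ℝ → ℂ := (Set.Icc (-1 / 2 : ℝ) (1 / 2)).indicator
    fun v : ℝ => cexp (2 * Real.pi * I * v * z) with hk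
  have hkint : Integrable k :=
    (Continuous.continuousOn (by fun_prop)).integrableOn_Icc.integrable_indicator measurableSet_Icc
  -- The multiplication formula `∫ f̂ g = ∫ f ĝ`; it also covers complex `z`, since `k` is
  -- integrable on the bounded band.
  have hflip : ∫ x : ℝ, FourierTransform.fourier k x * fourierBinom (w + 2) x =
      ∫ v : ℝ, k v * FourierTransform.fourier (fun x : ℝ => fourierBinom (w + 2) x) v := by
    simpa using! VectorFourier.integral_fourierIntegral_smul_eq_flip (L := innerₗ ℝ)
      Real.continuous_fourierChar continuous_inner hkint (integrable_fourierBinom_add_two hw)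
  simp only [hk, fourier_indicator_exp] at hflip
  simp only [mul_comm (fourierBinom (w + 2) _)]
  rw [hflip, ← integral_neg_eq_self, fourierBinom, intervalIntegral.integral_of_le (by norm_num),
    ← integral_Icc_eq_integral_Ioc, ← integral_indicator measurableSet_Icc]
  refine integral_congr_ae (ae_of_all _ fun v => ?_)
  simp only [fourier_fourierBinom hw, neg_neg]
  by_cases hv : v ∈ Set.Icc (-1 / 2 : ℝ) (1 / 2)
  · have hv' : -v ∈ Set.Icc (-1 / 2 : ℝ) (1 / 2) := ⟨by linarith [hv.2], by linarith [hv.1]⟩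
    rw [Set.indicator_of_mem hv, Set.indicator_of_mem hv, Set.indicator_of_mem hv']
    simp only [binomKernel]
    rw [mul_left_comm, ← Complex.exp_add]
    congr 2
    push_cast
    ring
  · rw [Set.indicator_of_notMem hv, Set.indicator_of_notMem hv, mul_zero]

theorem mainTheorem5 (w z : ℂ) (hw : -1 < w.re) :
    MeasureTheory.Integrable
        (fun x : ℝ => complexBinom w (x : ℂ) * normalizedSinc ((x : ℂ) - z))
        MeasureTheory.volume ∧
      ∫ x : ℝ, complexBinom w (x : ℂ) * normalizedSinc ((x : ℂ) - z) = complexBinom w z := by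
  refine ⟨integrable_complexBinom_mul_normalizedSinc hw z, ?_⟩
  -- Three descents: `w + 3 = (w + 1) + 2` with `Re (w + 1) > 0`, where Fourier inversion applies.
  refine integral_complexBinom_mul_normalizedSinc_of_add_one hw (fun z => ?_) z
  refine integral_complexBinom_mul_normalizedSinc_of_add_one (by simp; linarith) (fun z => ?_) z
  refine integral_complexBinom_mul_normalizedSinc_of_add_one (by simp; linarith) (fun z => ?_) z
  rw [show w + 1 + 1 + 1 = (w + 1) + 2 by ring]
  exact integral_complexBinom_mul_normalizedSinc_add_two (by simp; linarith) z
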